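/- Let $d\ge 0$ be an integer and let $f:\mathbb{R}^d\to[0,\infty)$ be a (Borel measurable) function with $$\int f(z)\,dz=1,\qquad \int z f(z)\,dz=0,\qquad \int \|z\|^2 f(z)\,dz<\infty ,$$ and consider the location family $p(z\mid\mu)=f(z-\mu)$, $\mu\in\mathbb{R}^d$. An observation $x\sim p(x\mid\mu)$ is used to predict $y\sim p(y\mid\mu)$ by a predictive density $\hat p(y\mid x)$, that is, a jointly measurable function that is a probability density in $y$ for every $x$. For probability distributions $P,Q$ on $\mathbb{R}^d$ let $W_2(P,Q)=\inf \mathrm{E}[\|X-Y\|^2]^{1/2}\in[0,\infty]$, the infimum being over all joint distributions of $(X,Y)$ with marginals $P$ and $Q$, and let the risk of $\hat p$ at $\mu$ be $$R(\mu,\hat p)=\int W_2\bigl(p(\cdot\mid\mu),\hat p(\cdot\mid x)\bigr)^2\,p(x\mid\mu)\,dx\in[0,\infty].$$ Call $\hat p$ equivariant if, for all $c,x\in\mathbb{R}^d$, $\hat p(y+c\mid x+c)=\hat p(y\mid x)$ for almost every $y$; call it best equivariant if it is equivariant and $R(\mu,\hat p)\le R(\mu,\hat q)$ for every $\mu$ and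 every equivariant predictive density $\hat q$; and call it minimax if $\sup_\mu R(\mu,\hat p)\le\sup_\mu R(\mu,\hat q)$ for every predictive density $\hat q$. Then the plug-in density $\hat p_*(y\mid x)=p(y\mid x)=f(y-x)$ with the usual estimator $\hat\mu(x)=x$ is best equivariant; it is the only best equivariant predictive density, in the sense that every best equivariant $\hat q$ satisfies, for every $x$, $\hat q(y\mid x)=f(y-x)$ for almost every $y$; and $\hat p_*$ is minimax. -/

import Mathlib

open MeasureTheory
open scoped ENNReal

noncomputable section

/-- A joint distribution on `S × S` with marginals `P` and `Q`. -/
def IsCoupling {S : Type*} [MeasurableSpace S] (P Q : Measure S) (γ : Measure (S × S)) : Prop :=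
  γ.map Prod.fst = P ∧ γ.map Prod.snd = Q

/-- The `L²` Wasserstein distance `inf E[d(X, Y)²]^{1/2}` over all joint distributions of `(X, Y)`
with marginals `P` and `Q`, with values in `[0, ∞]`. -/
def wassersteinTwo {S : Type*} [MeasurableSpace S] [PseudoEMetricSpace S]
    (P Q : Measure S) : ℝ≥0∞ :=
  ⨅ (γ : Measure (S × S)) (_ : IsCoupling P Q γ), (∫⁻ z, edist z.1 z.2 ^ 2 ∂γ) ^ (1 / 2 : ℝ)

/-- The distribution on `ℝ^d` with Lebesgue density `g`. -/
def distOf {d : ℕ} (g : EuclideanSpace ℝ (Fin d) → ℝ) : Measure (EuclideanSpace ℝ (Fin d)) :=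
  volume.withDensity fun z => ENNReal.ofReal (g z)

/-- The location family `p(z | μ) = f(z - μ)`. -/
def locDensity {d : ℕ} (f : EuclideanSpace ℝ (Fin d) → ℝ) (μ z : EuclideanSpace ℝ (Fin d)) : ℝ :=
  f (z - μ)

/-- `p x y` is a predictive density `p̂(y | x)`: jointly measurable, and for each observation `x` a
probability density in `y`. -/
structure IsPredictiveDensity {d : ℕ}
    (p : EuclideanSpace ℝ (Fin d) → EuclideanSpace ℝ (Fin d) → ℝ) : Prop where
  measurable : Measurable (Function.uncurry p)
  nonneg : ∀ x y, 0 ≤ p x y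
  integral_eq_one : ∀ x, ∫ y, p x y = 1

/-- The plug-in density `p(y | μ̂(x))`. -/
def plugIn {d : ℕ} (f : EuclideanSpace ℝ (Fin d) → ℝ)
    (est : EuclideanSpace ℝ (Fin d) → EuclideanSpace ℝ (Fin d))
    (x y : EuclideanSpace ℝ (Fin d)) : ℝ :=
  locDensity f (est x) y

/-- The risk `R(μ, p̂) = ∫ W₂(p(y | μ), p̂(y | x))² p(x | μ) dx`, with values in `[0, ∞]`. -/
def wassersteinRisk {d : ℕ} (f : EuclideanSpace ℝ (Fin d) → ℝ) (μ : EuclideanSpace ℝ (Fin d))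
    (p : EuclideanSpace ℝ (Fin d) → EuclideanSpace ℝ (Fin d) → ℝ) : ℝ≥0∞ :=
  ∫⁻ x, wassersteinTwo (distOf (locDensity f μ)) (distOf (p x)) ^ 2 ∂(distOf (locDensity f μ))

/-- Equivariance under the translations `(x, y, μ) ↦ (x + c, y + c, μ + c)`; since `p x` matters
only as the density of a distribution, the identity is required for almost every `y`. -/
def IsEquivariant {d : ℕ}
    (p : EuclideanSpace ℝ (Fin d) → EuclideanSpace ℝ (Fin d) → ℝ) : Prop :=
  ∀ c x, ∀ᵐ y, p (x + c) (y + c) = p x y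

/-- `p` is an equivariant predictive density whose risk is, at every parameter value, minimal among
all equivariant predictive densities. -/
structure IsBestEquivariant {d : ℕ} (f : EuclideanSpace ℝ (Fin d) → ℝ)
    (p : EuclideanSpace ℝ (Fin d) → EuclideanSpace ℝ (Fin d) → ℝ) : Prop where
  predictive : IsPredictiveDensity p
  equivariant : IsEquivariant p
  risk_le : ∀ q, IsPredictiveDensity q → IsEquivariant q →
    ∀ μ, wassersteinRisk f μ p ≤ wassersteinRisk f μ q

/-- `p` is a predictive density that minimizes the maximum risk among all predictive densities. -/
structure IsMinimax {d : ℕ} (f : EuclideanSpace ℝ (Fin d) → ℝ)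
    (p : EuclideanSpace ℝ (Fin d) → EuclideanSpace ℝ (Fin d) → ℝ) : Prop where
  predictive : IsPredictiveDensity p
  sup_risk_le : ∀ q, IsPredictiveDensity q →
    ⨆ μ, wassersteinRisk f μ p ≤ ⨆ μ, wassersteinRisk f μ q

end

/-!
The squared Wasserstein distance is the squared difference of the means plus the squared distance
between the centred distributions. Write `P` for the law with density `f` and `σ²` for its total
variance. The plug-in rule predicts a translate of the true law, so its risk is at most `σ²`. For an
equivariant rule `κ` the law `κ x` is `κ 0` translated by `x`, and averaging over `x` the cross
term vanishes, so that the risk is at least `W₂(P, κ 0)² + σ²`: this gives optimality, and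
uniqueness because `W₂` separates laws.

For minimaxity, the mean of `κ x` is an estimator of the location whose quadratic risk is at most
the risk of `κ`. Take as prior for the location the law of a sum of `n` independent copies of `P`.
The observation is then a sum `s` of `n + 1` independent copies `z i`, and by exchangeability each
of them can play the role of the noise, so the best prediction of the noise from `s` is
`s / (n + 1)` and the Bayes risk is `n σ² / (n + 1)`. Letting `n → ∞` bounds the maximal risk below
by `σ²`.
-/

open ProbabilityTheory

section Coupling

variable {S : Type*} [MeasurableSpace S] {P Q : Measure S} {γ : Measure (S × S)}

theorem IsCoupling.isProbabilityMeasure [IsProbabilityMeasure P] (h : IsCoupling P Q γ) :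
    IsProbabilityMeasure γ :=
  have : IsProbabilityMeasure (γ.map Prod.fst) := h.1.symm ▸ ‹IsProbabilityMeasure P›
  Measure.isProbabilityMeasure_of_map Prod.fst

theorem IsCoupling.map {T : Type*} [MeasurableSpace T] (h : IsCoupling P Q γ) {s t : S → T}
    (hs : Measurable s) (ht : Measurable t) :
    IsCoupling (P.map s) (Q.map t) (γ.map (Prod.map s t)) := by
  refine ⟨?_, ?_⟩
  · rw [← h.1, Measure.map_map measurable_fst (hs.prodMap ht), Measure.map_map hs measurable_fst]
    rfl
  · rw [← h.2, Measure.map_map measurable_snd (hs.prodMap ht), Measure.map_map ht measurable_snd]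
    rfl

theorem IsCoupling.map_sub_const {G : Type*} [AddGroup G] [MeasurableSpace G] [MeasurableAdd G]
    [MeasurableSub G] {P Q : Measure G} {γ : Measure (G × G)} {u v : G}
    (h : IsCoupling (P.map (· + u)) (Q.map (· + v)) γ) :
    IsCoupling P Q (γ.map (Prod.map (· - u) (· - v))) := by
  have hmap := h.map (s := (· - u)) (t := (· - v)) (by fun_prop) (by fun_prop)
  rw [Measure.map_map (by fun_prop) (by fun_prop),
    Measure.map_map (by fun_prop) (by fun_prop)] at hmap
  simpa [Function.comp_def] using hmap

theorem isCoupling_map_prodMk {R : Type*} [MeasurableSpace R] (μ : Measure R) {s t : R → S}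
    (hs : Measurable s) (ht : Measurable t) :
    IsCoupling (μ.map s) (μ.map t) (μ.map fun x => (s x, t x)) :=
  ⟨Measure.map_map measurable_fst (hs.prodMk ht), Measure.map_map measurable_snd (hs.prodMk ht)⟩

variable [PseudoEMetricSpace S]

theorem IsCoupling.wassersteinTwo_sq_le (h : IsCoupling P Q γ) :
    wassersteinTwo P Q ^ 2 ≤ ∫⁻ z, edist z.1 z.2 ^ 2 ∂γ := by
  calc wassersteinTwo P Q ^ 2
      ≤ ((∫⁻ z, edist z.1 z.2 ^ 2 ∂γ) ^ (1 / 2 : ℝ)) ^ 2 := by gcongr; exact iInf₂_le γ h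
    _ = ∫⁻ z, edist z.1 z.2 ^ 2 ∂γ := by rw [← ENNReal.rpow_mul_natCast]; norm_num

theorem le_wassersteinTwo_sq {c : ℝ≥0∞}
    (h : ∀ γ : Measure (S × S), IsCoupling P Q γ → c ≤ ∫⁻ z, edist z.1 z.2 ^ 2 ∂γ) :
    c ≤ wassersteinTwo P Q ^ 2 := by
  have hsqrt : c ^ (1 / 2 : ℝ) ≤ wassersteinTwo P Q :=
    le_iInf₂ fun γ hγ => ENNReal.rpow_le_rpow (h γ hγ) (by norm_num)
  calc c = (c ^ (1 / 2 : ℝ)) ^ 2 := by rw [← ENNReal.rpow_mul_natCast]; norm_num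
    _ ≤ wassersteinTwo P Q ^ 2 := by gcongr

theorem IsCoupling.measure_le_measure_thickening_add (h : IsCoupling P Q γ)
    [OpensMeasurableSpace S] {B : Set S} (hB : MeasurableSet B) {ε : ℝ≥0∞} (hε : ε ≠ ∞) :
    P B ≤ Q (Metric.thickening ε.toReal B) + γ {z | ε ≤ edist z.1 z.2} := by
  have hsub : Prod.fst ⁻¹' B ⊆
      Prod.snd ⁻¹' Metric.thickening ε.toReal B ∪ {z : S × S | ε ≤ edist z.1 z.2} := by
    rintro ⟨x, y⟩ hx
    refine (lt_or_ge (edist x y) ε).imp (fun hlt => ?_) id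
    rw [Set.mem_preimage, Metric.mem_thickening_iff_exists_edist_lt, ENNReal.ofReal_toReal hε]
    exact ⟨x, hx, edist_comm x y ▸ hlt⟩
  rw [← h.1, ← h.2, Measure.map_apply measurable_fst hB,
    Measure.map_apply measurable_snd Metric.isOpen_thickening.measurableSet]
  exact (measure_mono hsub).trans (measure_union_le _ _)

theorem levyProkhorovEDist_pow_three_le_wassersteinTwo_sq [OpensMeasurableSpace S]
    [SecondCountableTopology S] [IsProbabilityMeasure P] [IsProbabilityMeasure Q] :
    levyProkhorovEDist P Q ^ 3 ≤ wassersteinTwo P Q ^ 2 := by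
  refine le_wassersteinTwo_sq fun γ hγ => ?_
  set cost := ∫⁻ z, edist z.1 z.2 ^ 2 ∂γ
  have hcube : (cost ^ (1 / 3 : ℝ)) ^ 3 = cost := by rw [← ENNReal.rpow_mul_natCast]; norm_num
  suffices hle : levyProkhorovEDist P Q ≤ cost ^ (1 / 3 : ℝ) by
    rw [← hcube]; gcongr
  refine levyProkhorovEDist_le_of_forall_le P Q _ fun ε B hε hε_top hB => ?_
  refine (hγ.measure_le_measure_thickening_add hB hε_top.ne).trans ?_
  gcongr
  have hε2 : ε ^ 2 ≠ 0 := pow_ne_zero _ (bot_lt_of_lt hε).ne'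
  have hmarkov : ε ^ 2 * γ {z | ε ≤ edist z.1 z.2} ≤ ε ^ 2 * ε :=
    calc ε ^ 2 * γ {z | ε ≤ edist z.1 z.2}
        = ε ^ 2 * γ {z | ε ^ 2 ≤ edist z.1 z.2 ^ 2} := by
          simp only [ENNReal.pow_le_pow_left_iff two_ne_zero]
      _ ≤ cost := mul_meas_ge_le_lintegral (by fun_prop) _
      _ ≤ ε ^ 2 * ε := by rw [← hcube, ← pow_succ]; gcongr
  exact (ENNReal.mul_le_mul_iff_right hε2 (ENNReal.pow_ne_top hε_top.ne)).1 hmarkov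

end Coupling

theorem eq_of_levyProkhorovEDist_eq_zero {S : Type*} [PseudoEMetricSpace S] [MeasurableSpace S]
    [BorelSpace S] {P Q : Measure S} [IsFiniteMeasure P] [IsFiniteMeasure Q]
    (h : levyProkhorovEDist P Q = 0) : P = Q := by
  have hclosed : ∀ A : Set S, IsClosed A → P A = Q A := fun A hA =>
    measure_eq_measure_of_levyProkhorovEDist_eq_zero_of_isClosed h hA
      ⟨1, one_pos, measure_ne_top P _⟩ ⟨1, one_pos, measure_ne_top Q _⟩
  exact ext_of_generate_finite {A : Set S | IsClosed A}
    (BorelSpace.measurable_eq.trans borel_eq_generateFrom_isClosed) isPiSystem_isClosed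
    hclosed (hclosed _ isClosed_univ)

theorem eq_of_wassersteinTwo_eq_zero {S : Type*} [PseudoEMetricSpace S] [MeasurableSpace S]
    [BorelSpace S] [SecondCountableTopology S] {P Q : Measure S} [IsProbabilityMeasure P]
    (h : wassersteinTwo P Q = 0) : P = Q := by
  obtain ⟨γ, hγ⟩ : ∃ γ, IsCoupling P Q γ := by
    by_contra hnone
    have htop : wassersteinTwo P Q = ∞ := iInf₂_eq_top.2 fun γ hγ => (hnone ⟨γ, hγ⟩).elim
    exact ENNReal.zero_ne_top (h.symm.trans htop)
  have := hγ.isProbabilityMeasure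
  have : IsProbabilityMeasure Q :=
    hγ.2 ▸ Measure.isProbabilityMeasure_map measurable_snd.aemeasurable
  refine eq_of_levyProkhorovEDist_eq_zero ?_
  simpa [h] using levyProkhorovEDist_pow_three_le_wassersteinTwo_sq (P := P) (Q := Q)

theorem lintegral_enorm_sq_eq_ofReal_integral {F Ω : Type*} [NormedAddCommGroup F]
    [MeasurableSpace Ω] {μ : Measure Ω} {X : Ω → F} (hX : MemLp X 2 μ) :
    ∫⁻ ω, ‖X ω‖ₑ ^ 2 ∂μ = ENNReal.ofReal (∫ ω, ‖X ω‖ ^ 2 ∂μ) := by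
  rw [ofReal_integral_eq_lintegral_ofReal ((memLp_two_iff_integrable_sq_norm hX.1).1 hX)
    (ae_of_all _ fun _ => sq_nonneg _)]
  simp only [ENNReal.ofReal_pow, norm_nonneg, ofReal_norm]

theorem lintegral_enorm_sq_ne_top {F Ω : Type*} [NormedAddCommGroup F] [MeasurableSpace Ω]
    {μ : Measure Ω} {X : Ω → F} (hX : MemLp X 2 μ) : ∫⁻ ω, ‖X ω‖ₑ ^ 2 ∂μ ≠ ∞ :=
  (lintegral_enorm_sq_eq_ofReal_integral hX).trans_ne ENNReal.ofReal_ne_top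

section BiasVariance

variable {E : Type*} [NormedAddCommGroup E] [InnerProductSpace ℝ E] [CompleteSpace E]
  {Ω : Type*} [MeasurableSpace Ω] {μ : Measure Ω} {X : Ω → E}

theorem lintegral_enorm_add_const_sq [IsProbabilityMeasure μ] (hX : MemLp X 2 μ) (v : E) :
    ∫⁻ ω, ‖X ω + v‖ₑ ^ 2 ∂μ + ‖∫ ω, X ω ∂μ‖ₑ ^ 2 =
      ∫⁻ ω, ‖X ω‖ₑ ^ 2 ∂μ + ‖∫ ω, X ω ∂μ + v‖ₑ ^ 2 := by
  have hXi : Integrable X μ := hX.integrable one_le_two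
  have hsq : Integrable (fun ω => ‖X ω‖ ^ 2) μ := hX.integrable_norm_pow'
  have hinner : Integrable (fun ω => 2 * inner ℝ (X ω) v) μ := (hXi.inner_const v).const_mul 2
  have hmean : ∫ ω, inner ℝ (X ω) v ∂μ = inner ℝ (∫ ω, X ω ∂μ) v := by
    simp only [real_inner_comm v]
    exact integral_inner hXi v
  have hreal : ∫ ω, ‖X ω + v‖ ^ 2 ∂μ + ‖∫ ω, X ω ∂μ‖ ^ 2 =
      ∫ ω, ‖X ω‖ ^ 2 ∂μ + ‖∫ ω, X ω ∂μ + v‖ ^ 2 := by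
    simp only [norm_add_sq_real]
    rw [integral_add (by exact hsq.add hinner) (integrable_const _), integral_add hsq hinner,
      integral_const_mul, hmean]
    simp only [integral_const, probReal_univ, one_smul]
    ring
  rw [lintegral_enorm_sq_eq_ofReal_integral (X := fun ω => X ω + v) (hX.add (memLp_const v)),
    lintegral_enorm_sq_eq_ofReal_integral hX]
  simp only [← ofReal_norm, ← ENNReal.ofReal_pow, norm_nonneg]
  rw [← ENNReal.ofReal_add (by positivity) (by positivity),
    ← ENNReal.ofReal_add (by positivity) (by positivity), hreal]

theorem enorm_integral_sq_le_lintegral_enorm_sq [IsProbabilityMeasure μ] (hX : MemLp X 2 μ) :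
    ‖∫ ω, X ω ∂μ‖ₑ ^ 2 ≤ ∫⁻ ω, ‖X ω‖ₑ ^ 2 ∂μ := by
  have h := lintegral_enorm_add_const_sq hX (-∫ ω, X ω ∂μ)
  rw [add_neg_cancel, enorm_zero, zero_pow two_ne_zero, add_zero] at h
  exact h ▸ le_add_self

theorem lintegral_enorm_add_sq_of_integral_eq_zero [IsProbabilityMeasure μ] (hX : MemLp X 2 μ)
    (hmean : ∫ ω, X ω ∂μ = 0) (v : E) :
    ∫⁻ ω, ‖X ω + v‖ₑ ^ 2 ∂μ = ∫⁻ ω, ‖X ω‖ₑ ^ 2 ∂μ + ‖v‖ₑ ^ 2 := by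
  have h := lintegral_enorm_add_const_sq hX v
  simpa only [hmean, enorm_zero, zero_pow two_ne_zero, add_zero, zero_add] using h

end BiasVariance

section Translation

variable {E : Type*} [NormedAddCommGroup E] [SecondCountableTopology E] [MeasurableSpace E]
  [BorelSpace E]

theorem memLp_two_sub_of_lintegral_edist_sq_ne_top {γ : Measure (E × E)}
    (h : ∫⁻ z, edist z.1 z.2 ^ 2 ∂γ ≠ ∞) : MemLp (fun z : E × E => z.1 - z.2) 2 γ := by
  refine ⟨by fun_prop, ?_⟩
  rw [eLpNorm_lt_top_iff_lintegral_rpow_enorm_lt_top two_ne_zero ENNReal.ofNat_ne_top]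
  simpa [edist_eq_enorm_sub, lt_top_iff_ne_top] using h

variable {P Q : Measure E} [IsProbabilityMeasure P]

theorem wassersteinTwo_map_add_sq_le (u v : E) :
    wassersteinTwo (P.map (· + u)) (P.map (· + v)) ^ 2 ≤ ‖u - v‖ₑ ^ 2 := by
  have hγ : IsCoupling (P.map (· + u)) (P.map (· + v)) (P.map fun x => (x + u, x + v)) :=
    isCoupling_map_prodMk P (by fun_prop) (by fun_prop)
  refine hγ.wassersteinTwo_sq_le.trans_eq ?_
  rw [lintegral_map (by fun_prop) (by fun_prop)]
  simp [edist_eq_enorm_sub]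

theorem IsCoupling.integral_sub [NormedSpace ℝ E] {γ : Measure (E × E)} (h : IsCoupling P Q γ)
    (hP : MemLp id 2 P) (hD : MemLp (fun z : E × E => z.1 - z.2) 2 γ) :
    ∫ z, (z.1 - z.2) ∂γ = ∫ x, x ∂P - ∫ y, y ∂Q := by
  have := h.isProbabilityMeasure
  have hfst : MemLp (fun z : E × E => z.1) 2 γ :=
    (h.1.symm ▸ hP : MemLp id 2 (γ.map Prod.fst)).comp_of_map measurable_fst.aemeasurable
  have hsnd : MemLp (fun z : E × E => z.2) 2 γ :=
    (hfst.sub hD).ae_eq (ae_of_all _ fun z => sub_sub_cancel z.1 z.2)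
  rw [MeasureTheory.integral_sub (hfst.integrable one_le_two) (hsnd.integrable one_le_two),
    ← h.1, ← h.2, integral_map measurable_fst.aemeasurable (by fun_prop),
    integral_map measurable_snd.aemeasurable (by fun_prop)]

variable [InnerProductSpace ℝ E] [CompleteSpace E]

theorem enorm_integral_sub_sq_le_wassersteinTwo_sq (hP : MemLp id 2 P) :
    ‖∫ x, x ∂P - ∫ y, y ∂Q‖ₑ ^ 2 ≤ wassersteinTwo P Q ^ 2 := by
  refine le_wassersteinTwo_sq fun γ hγ => ?_
  by_cases htop : ∫⁻ z, edist z.1 z.2 ^ 2 ∂γ = ∞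
  · exact htop ▸ le_top
  have hD := memLp_two_sub_of_lintegral_edist_sq_ne_top htop
  have := hγ.isProbabilityMeasure
  simp only [← hγ.integral_sub hP hD, edist_eq_enorm_sub]
  exact enorm_integral_sq_le_lintegral_enorm_sq hD

theorem wassersteinTwo_sq_add_le_wassersteinTwo_sq_map_add (hP : MemLp id 2 P) (u v : E) :
    wassersteinTwo P Q ^ 2 + ‖∫ x, x ∂P - ∫ y, y ∂Q + (u - v)‖ₑ ^ 2 ≤
      wassersteinTwo (P.map (· + u)) (Q.map (· + v)) ^ 2 + ‖∫ x, x ∂P - ∫ y, y ∂Q‖ₑ ^ 2 := by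
  rw [← tsub_le_iff_right]
  refine le_wassersteinTwo_sq fun γ hγ => tsub_le_iff_right.2 ?_
  by_cases htop : ∫⁻ z, edist z.1 z.2 ^ 2 ∂γ = ∞
  · exact htop ▸ le_top
  set s : E × E → E × E := Prod.map (· - u) (· - v)
  have hs : Measurable s := by fun_prop
  have hback : IsCoupling P Q (γ.map s) := hγ.map_sub_const
  have hD : MemLp (fun z : E × E => z.1 - z.2) 2 (γ.map s) := by
    have : IsProbabilityMeasure (P.map (· + u)) := Measure.isProbabilityMeasure_map (by fun_prop)
    have := hγ.isProbabilityMeasure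
    rw [memLp_map_measure_iff (by fun_prop) hs.aemeasurable]
    convert (memLp_two_sub_of_lintegral_edist_sq_ne_top htop).sub (memLp_const (u - v)) using 1
    ext z
    simp only [s, Function.comp_apply, Prod.map_fst, Prod.map_snd, Pi.sub_apply]
    abel
  have := hback.isProbabilityMeasure
  calc wassersteinTwo P Q ^ 2 + ‖∫ x, x ∂P - ∫ y, y ∂Q + (u - v)‖ₑ ^ 2
      ≤ ∫⁻ z, ‖z.1 - z.2‖ₑ ^ 2 ∂(γ.map s) + ‖∫ x, x ∂P - ∫ y, y ∂Q + (u - v)‖ₑ ^ 2 := by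
        gcongr
        simpa only [edist_eq_enorm_sub] using hback.wassersteinTwo_sq_le
    _ = ∫⁻ z, ‖z.1 - z.2 + (u - v)‖ₑ ^ 2 ∂(γ.map s) + ‖∫ x, x ∂P - ∫ y, y ∂Q‖ₑ ^ 2 := by
        rw [← hback.integral_sub hP hD, lintegral_enorm_add_const_sq hD]
    _ = ∫⁻ z, edist z.1 z.2 ^ 2 ∂γ + ‖∫ x, x ∂P - ∫ y, y ∂Q‖ₑ ^ 2 := by
        rw [lintegral_map (by fun_prop) hs]
        congr 2 with z
        rw [edist_eq_enorm_sub]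
        congr 2
        simp only [s, Prod.map_fst, Prod.map_snd]
        abel

end Translation

section EstimationOfLocation

theorem card_mul_sum_norm_sq_le {ι F : Type*} [NormedAddCommGroup F] [InnerProductSpace ℝ F]
    (s : Finset ι) (z : ι → F) (b : F) :
    s.card * ∑ i ∈ s, ‖z i‖ ^ 2 ≤ s.card * ∑ i ∈ s, ‖z i - b‖ ^ 2 + ‖∑ i ∈ s, z i‖ ^ 2 := by
  have hsum : ∑ i ∈ s, ‖z i - b‖ ^ 2 =
      ∑ i ∈ s, ‖z i‖ ^ 2 - 2 * inner ℝ (∑ i ∈ s, z i) b + s.card * ‖b‖ ^ 2 := by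
    simp only [norm_sub_sq_real, Finset.sum_add_distrib, Finset.sum_sub_distrib, Finset.sum_const,
      nsmul_eq_mul, ← Finset.mul_sum, sum_inner]
  have hsq : ‖∑ i ∈ s, z i - (s.card : ℝ) • b‖ ^ 2 =
      ‖∑ i ∈ s, z i‖ ^ 2 - 2 * (s.card * inner ℝ (∑ i ∈ s, z i) b) + s.card ^ 2 * ‖b‖ ^ 2 := by
    rw [norm_sub_sq_real, real_inner_smul_right, norm_smul, mul_pow, Real.norm_natCast]
  rw [hsum]
  linarith [sq_nonneg ‖∑ i ∈ s, z i - (s.card : ℝ) • b‖]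

theorem card_mul_sum_enorm_sq_le {ι F : Type*} [NormedAddCommGroup F] [InnerProductSpace ℝ F]
    (s : Finset ι) (z : ι → F) (b : F) :
    s.card * ∑ i ∈ s, ‖z i‖ₑ ^ 2 ≤ s.card * ∑ i ∈ s, ‖z i - b‖ₑ ^ 2 + ‖∑ i ∈ s, z i‖ₑ ^ 2 := by
  have h := card_mul_sum_norm_sq_le s z b
  simp only [← coe_nnnorm] at h
  simp only [enorm_eq_nnnorm]
  exact_mod_cast h

theorem lintegral_pi_fin_succ {n : ℕ} {α : Type*} [MeasurableSpace α] (μ : Measure α)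
    [SigmaFinite μ] (i : Fin (n + 1)) {F : (Fin (n + 1) → α) → ℝ≥0∞} (hF : Measurable F) :
    ∫⁻ z, F z ∂(Measure.pi fun _ => μ) =
      ∫⁻ w, ∫⁻ x, F (i.insertNth x w) ∂μ ∂(Measure.pi fun _ : Fin n => μ) := by
  have he := (measurePreserving_piFinSuccAbove (fun _ : Fin (n + 1) => μ) i).symm
  rw [← he.lintegral_comp hF]
  exact lintegral_prod_symm _ (hF.comp he.measurable).aemeasurable

variable {E : Type*} [NormedAddCommGroup E] [MeasurableSpace E] [BorelSpace E]
  [SecondCountableTopology E] {P : Measure E} [IsProbabilityMeasure P]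

theorem lintegral_enorm_apply_sub_sq_pi_le {m : E → E} (hm : Measurable m) {r : ℝ≥0∞}
    (hr : ∀ u, ∫⁻ z, ‖m (z + u) - u‖ₑ ^ 2 ∂P ≤ r) {n : ℕ} (i : Fin (n + 1)) :
    ∫⁻ z, ‖z i - (∑ j, z j - m (∑ j, z j))‖ₑ ^ 2 ∂(Measure.pi fun _ : Fin (n + 1) => P) ≤ r := by
  rw [lintegral_pi_fin_succ P i (by fun_prop)]
  have hinner (w : Fin n → E) (x : E) :
      i.insertNth (α := fun _ => E) x w i - (∑ j, i.insertNth (α := fun _ => E) x w j -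
        m (∑ j, i.insertNth (α := fun _ => E) x w j)) = m (x + ∑ j, w j) - ∑ j, w j := by
    simp only [Fin.sum_univ_succAbove _ i, Fin.insertNth_apply_same, Fin.insertNth_apply_succAbove]
    abel
  simp only [hinner]
  calc ∫⁻ w, ∫⁻ x, ‖m (x + ∑ j, w j) - ∑ j, w j‖ₑ ^ 2 ∂P ∂(Measure.pi fun _ : Fin n => P)
      ≤ ∫⁻ _, r ∂(Measure.pi fun _ : Fin n => P) := lintegral_mono fun w => hr _
    _ = r := by rw [lintegral_const, measure_univ, mul_one]

variable [InnerProductSpace ℝ E] [CompleteSpace E]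

theorem lintegral_enorm_sum_sq_pi (hP : MemLp id 2 P) (hmean : ∫ z, z ∂P = 0) (n : ℕ) :
    ∫⁻ z, ‖∑ i, z i‖ₑ ^ 2 ∂(Measure.pi fun _ : Fin n => P) = n * ∫⁻ z, ‖z‖ₑ ^ 2 ∂P := by
  induction n with
  | zero => simp
  | succ n ih =>
    rw [lintegral_pi_fin_succ P 0 (by fun_prop)]
    simp only [Fin.sum_univ_succAbove _ 0, Fin.insertNth_apply_same, Fin.insertNth_apply_succAbove,
      lintegral_enorm_add_sq_of_integral_eq_zero (X := fun z => z) hP hmean]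
    rw [lintegral_add_left measurable_const, ih, lintegral_const, measure_univ, mul_one]
    push_cast
    ring

/- A Bayes risk bound: if the location is a sum of `n` independent copies of the noise, then the
observation is a sum of `n + 1` copies, any one of which may be regarded as the noise. -/
theorem natCast_mul_lintegral_enorm_sq_le (hP : MemLp id 2 P) (hmean : ∫ z, z ∂P = 0) {m : E → E}
    (hm : Measurable m) {r : ℝ≥0∞} (hr : ∀ u, ∫⁻ z, ‖m (z + u) - u‖ₑ ^ 2 ∂P ≤ r) (n : ℕ) :
    n * ∫⁻ z, ‖z‖ₑ ^ 2 ∂P ≤ (n + 1) * r := by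
  set σ2 := ∫⁻ z, ‖z‖ₑ ^ 2 ∂P
  set Pn : Measure (Fin (n + 1) → E) := Measure.pi fun _ => P
  have hnoise (i : Fin (n + 1)) : ∫⁻ z, ‖z i‖ₑ ^ 2 ∂Pn = σ2 :=
    (measurePreserving_eval (fun _ => P) i).lintegral_comp (f := fun x => ‖x‖ₑ ^ 2) (by fun_prop)
  have hsum : (n + 1) * ((n + 1) * σ2) ≤ (n + 1) * ((n + 1) * r + σ2) :=
    calc (n + 1) * ((n + 1) * σ2)
        = ∫⁻ z, (n + 1) * ∑ i, ‖z i‖ₑ ^ 2 ∂Pn := by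
          rw [lintegral_const_mul _ (by fun_prop), lintegral_finsetSum _ (by fun_prop)]
          simp [hnoise]
      _ ≤ ∫⁻ z, ((n + 1) * ∑ i, ‖z i - (∑ j, z j - m (∑ j, z j))‖ₑ ^ 2 + ‖∑ i, z i‖ₑ ^ 2) ∂Pn :=
          lintegral_mono fun z => by
            simpa using card_mul_sum_enorm_sq_le Finset.univ z (∑ j, z j - m (∑ j, z j))
      _ = (n + 1) * ∑ i, ∫⁻ z, ‖z i - (∑ j, z j - m (∑ j, z j))‖ₑ ^ 2 ∂Pn + (n + 1) * σ2 := by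
          rw [lintegral_add_right _ (by fun_prop), lintegral_const_mul _ (by fun_prop),
            lintegral_finsetSum _ (by fun_prop), lintegral_enorm_sum_sq_pi hP hmean]
          simp [σ2]
      _ ≤ (n + 1) * ∑ _i : Fin (n + 1), r + (n + 1) * σ2 := by
          gcongr with i
          exact lintegral_enorm_apply_sub_sq_pi_le hm hr i
      _ = (n + 1) * ((n + 1) * r + σ2) := by simp [mul_add]
  have hle : n * σ2 + σ2 ≤ (n + 1) * r + σ2 := by
    rw [← add_one_mul]
    exact (ENNReal.mul_le_mul_iff_right (by simp) (by finiteness)).1 hsum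
  have hfin : σ2 ≠ ∞ := lintegral_enorm_sq_ne_top (X := fun z => z) hP
  exact (ENNReal.add_le_add_iff_right hfin).1 hle

theorem lintegral_enorm_sq_le_iSup_lintegral_enorm_sub_sq (hP : MemLp id 2 P)
    (hmean : ∫ z, z ∂P = 0) {m : E → E} (hm : Measurable m) :
    ∫⁻ z, ‖z‖ₑ ^ 2 ∂P ≤ ⨆ u, ∫⁻ z, ‖m (z + u) - u‖ₑ ^ 2 ∂P := by
  set r := ⨆ u, ∫⁻ z, ‖m (z + u) - u‖ₑ ^ 2 ∂P
  have hbayes := natCast_mul_lintegral_enorm_sq_le hP hmean hm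
    (le_iSup fun u => ∫⁻ z, ‖m (z + u) - u‖ₑ ^ 2 ∂P)
  by_contra! hlt
  obtain ⟨ε, hε⟩ := exists_add_of_le hlt.le
  have hε0 : ε ≠ 0 := by
    rintro rfl
    exact hlt.ne' (by simpa using hε)
  have hr : r ≠ ∞ := hlt.ne_top
  obtain ⟨n, hn⟩ := ENNReal.exists_nat_mul_gt hε0 hr
  have hle : n * r + n * ε ≤ n * r + r := by
    rw [← mul_add, ← hε, ← add_one_mul]
    exact hbayes n
  exact hn.not_ge ((ENNReal.add_le_add_iff_left (by finiteness)).1 hle)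

end EstimationOfLocation

section PredictiveKernels

/-- The location family generated by `P`, as a kernel: at `x` it is the law of `x + z` with
`z ∼ P`. As a predictive kernel it is the plug-in rule for the estimator `x` of the location. -/
noncomputable def locationKernel {G : Type*} [AddMonoid G] [MeasurableSpace G] [MeasurableAdd₂ G]
    (P : Measure G) : Kernel G G :=
  (Kernel.id ×ₖ Kernel.const G P).map fun p => p.2 + p.1

/-- The squared Wasserstein risk at location `u` of a predictive kernel `κ`, the observation and
the quantity to be predicted both following the law of `u + z` with `z ∼ P`. -/
noncomputable def kernelRisk {G : Type*} [AddMonoid G] [MeasurableSpace G] [PseudoEMetricSpace G]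
    [MeasurableAdd₂ G] (P : Measure G) (u : G) (κ : Kernel G G) : ℝ≥0∞ :=
  ∫⁻ x, wassersteinTwo (locationKernel P u) (κ x) ^ 2 ∂(locationKernel P u)

/-- Equivariance of a predictive kernel under a common translation of observation and
prediction. -/
def IsTranslationEquivariant {G : Type*} [Add G] [MeasurableSpace G] (κ : Kernel G G) : Prop :=
  ∀ c x, κ (x + c) = (κ x).map (· + c)

theorem locationKernel_apply {G : Type*} [AddMonoid G] [MeasurableSpace G] [MeasurableAdd₂ G]
    (P : Measure G) [SFinite P] (x : G) : locationKernel P x = P.map (· + x) := by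
  rw [locationKernel, Kernel.map_apply _ (by fun_prop), Kernel.prod_apply, Kernel.id_apply,
    Kernel.const_apply, Measure.dirac_prod, Measure.map_map (by fun_prop) (by fun_prop)]
  rfl

theorem isTranslationEquivariant_locationKernel {G : Type*} [AddMonoid G] [MeasurableSpace G]
    [MeasurableAdd₂ G] (P : Measure G) [SFinite P] :
    IsTranslationEquivariant (locationKernel P) := fun c x => by
  rw [locationKernel_apply, locationKernel_apply, Measure.map_map (by fun_prop) (by fun_prop)]
  simp only [Function.comp_def, add_assoc]

theorem IsTranslationEquivariant.eq_map_zero {G : Type*} [AddZeroClass G] [MeasurableSpace G]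
    {κ : Kernel G G} (h : IsTranslationEquivariant κ) (x : G) : κ x = (κ 0).map (· + x) := by
  simpa only [zero_add] using h x 0

variable {E : Type*} [NormedAddCommGroup E] [MeasurableSpace E] [BorelSpace E]
  [SecondCountableTopology E] {P : Measure E} [IsProbabilityMeasure P] {κ : Kernel E E}

theorem kernelRisk_eq_lintegral (u : E) (κ : Kernel E E) :
    kernelRisk P u κ = ∫⁻ z, wassersteinTwo (P.map (· + u)) (κ (z + u)) ^ 2 ∂P := by
  rw [kernelRisk, locationKernel_apply]
  exact lintegral_map_equiv _ (MeasurableEquiv.addRight u)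

theorem kernelRisk_locationKernel_le_lintegral_enorm_sq (u : E) :
    kernelRisk P u (locationKernel P) ≤ ∫⁻ z, ‖z‖ₑ ^ 2 ∂P := by
  rw [kernelRisk_eq_lintegral]
  refine lintegral_mono fun z => ?_
  rw [locationKernel_apply]
  simpa using wassersteinTwo_map_add_sq_le (P := P) u (z + u)

variable [InnerProductSpace ℝ E] [CompleteSpace E]

theorem IsTranslationEquivariant.wassersteinTwo_sq_add_le_kernelRisk
    (hκ : IsTranslationEquivariant κ) (hP : MemLp id 2 P) (hmean : ∫ z, z ∂P = 0) (u : E) :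
    wassersteinTwo P (κ 0) ^ 2 + ∫⁻ z, ‖z‖ₑ ^ 2 ∂P ≤ kernelRisk P u κ := by
  set Δ := ∫ x, x ∂P - ∫ y, y ∂(κ 0)
  have hshift (z : E) : wassersteinTwo P (κ 0) ^ 2 + ‖-z + Δ‖ₑ ^ 2 ≤
      wassersteinTwo (P.map (· + u)) (κ (z + u)) ^ 2 + ‖Δ‖ₑ ^ 2 := by
    have h := wassersteinTwo_sq_add_le_wassersteinTwo_sq_map_add (Q := κ 0) hP u (z + u)
    rwa [← hκ.eq_map_zero, sub_add_cancel_right, add_comm _ (-z)] at h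
  have hneg : ∫⁻ z, ‖-z + Δ‖ₑ ^ 2 ∂P = ∫⁻ z, ‖z‖ₑ ^ 2 ∂P + ‖Δ‖ₑ ^ 2 := by
    have h := lintegral_enorm_add_sq_of_integral_eq_zero (X := fun z => -z) (MemLp.neg hP)
      (by rw [integral_neg, hmean, neg_zero]) Δ
    simpa only [enorm_neg] using h
  refine (ENNReal.add_le_add_iff_right (a := ‖Δ‖ₑ ^ 2) (by finiteness)).1 ?_
  calc wassersteinTwo P (κ 0) ^ 2 + ∫⁻ z, ‖z‖ₑ ^ 2 ∂P + ‖Δ‖ₑ ^ 2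
      = ∫⁻ z, (wassersteinTwo P (κ 0) ^ 2 + ‖-z + Δ‖ₑ ^ 2) ∂P := by
        rw [lintegral_add_left measurable_const, lintegral_const, measure_univ, mul_one, hneg,
          add_assoc]
    _ ≤ ∫⁻ z, (wassersteinTwo (P.map (· + u)) (κ (z + u)) ^ 2 + ‖Δ‖ₑ ^ 2) ∂P :=
        lintegral_mono hshift
    _ = kernelRisk P u κ + ‖Δ‖ₑ ^ 2 := by
        rw [lintegral_add_right _ measurable_const, lintegral_const, measure_univ, mul_one,
          kernelRisk_eq_lintegral]

theorem IsTranslationEquivariant.kernelRisk_locationKernel_le (hκ : IsTranslationEquivariant κ)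
    (hP : MemLp id 2 P) (hmean : ∫ z, z ∂P = 0) (u : E) :
    kernelRisk P u (locationKernel P) ≤ kernelRisk P u κ :=
  (kernelRisk_locationKernel_le_lintegral_enorm_sq u).trans <|
    le_add_self.trans (hκ.wassersteinTwo_sq_add_le_kernelRisk hP hmean u)

theorem IsTranslationEquivariant.eq_locationKernel (hκ : IsTranslationEquivariant κ)
    (hP : MemLp id 2 P) (hmean : ∫ z, z ∂P = 0) {u : E}
    (hle : kernelRisk P u κ ≤ kernelRisk P u (locationKernel P)) : κ = locationKernel P := by
  have hσ : ∫⁻ z, ‖z‖ₑ ^ 2 ∂P ≠ ∞ := lintegral_enorm_sq_ne_top (X := fun z => z) hP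
  have hadd : wassersteinTwo P (κ 0) ^ 2 + ∫⁻ z, ‖z‖ₑ ^ 2 ∂P ≤ 0 + ∫⁻ z, ‖z‖ₑ ^ 2 ∂P := by
    rw [zero_add]
    exact (hκ.wassersteinTwo_sq_add_le_kernelRisk hP hmean u).trans
      (hle.trans (kernelRisk_locationKernel_le_lintegral_enorm_sq u))
  have hzero : wassersteinTwo P (κ 0) = 0 :=
    eq_zero_of_pow_eq_zero (nonpos_iff_eq_zero.1 ((ENNReal.add_le_add_iff_right hσ).1 hadd))
  ext1 x
  rw [hκ.eq_map_zero, ← eq_of_wassersteinTwo_eq_zero hzero, locationKernel_apply]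

theorem lintegral_enorm_sq_le_iSup_kernelRisk (hP : MemLp id 2 P) (hmean : ∫ z, z ∂P = 0)
    (κ : Kernel E E) : ∫⁻ z, ‖z‖ₑ ^ 2 ∂P ≤ ⨆ u, kernelRisk P u κ := by
  have hm : Measurable fun x => ∫ y, y ∂(κ x) :=
    (StronglyMeasurable.integral_kernel (κ := κ) stronglyMeasurable_id).measurable
  refine (lintegral_enorm_sq_le_iSup_lintegral_enorm_sub_sq hP hmean hm).trans
    (iSup_mono fun u => ?_)
  rw [kernelRisk_eq_lintegral]
  refine lintegral_mono fun z => ?_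
  have hPu : IsProbabilityMeasure (P.map (· + u)) := Measure.isProbabilityMeasure_map (by fun_prop)
  have hLu : MemLp id 2 (P.map (· + u)) :=
    (memLp_map_measure_iff (by fun_prop) (by fun_prop)).2 (hP.add (memLp_const u))
  have hmean_u : ∫ y, y ∂(P.map (· + u)) = u := by
    rw [integral_map (by fun_prop) (by fun_prop),
      integral_add (f := fun x => x) (hP.integrable one_le_two) (integrable_const u), hmean]
    simp
  simpa only [hmean_u, enorm_sub_rev u] using
    enorm_integral_sub_sq_le_wassersteinTwo_sq (Q := κ (z + u)) hLu

theorem iSup_kernelRisk_locationKernel_le (hP : MemLp id 2 P) (hmean : ∫ z, z ∂P = 0)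
    (κ : Kernel E E) : ⨆ u, kernelRisk P u (locationKernel P) ≤ ⨆ u, kernelRisk P u κ :=
  (iSup_le kernelRisk_locationKernel_le_lintegral_enorm_sq).trans
    (lintegral_enorm_sq_le_iSup_kernelRisk hP hmean κ)

theorem mainTheorem7_general (hP : MemLp id 2 P) (hmean : ∫ z, z ∂P = 0) :
    (IsTranslationEquivariant (locationKernel P) ∧
      ∀ κ : Kernel E E, IsTranslationEquivariant κ →
        ∀ u, kernelRisk P u (locationKernel P) ≤ kernelRisk P u κ) ∧
    (∀ κ : Kernel E E, IsTranslationEquivariant κ →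
      ∀ u, kernelRisk P u κ ≤ kernelRisk P u (locationKernel P) → κ = locationKernel P) ∧
    ∀ κ : Kernel E E, ⨆ u, kernelRisk P u (locationKernel P) ≤ ⨆ u, kernelRisk P u κ :=
  ⟨⟨isTranslationEquivariant_locationKernel P,
      fun _ hκ => hκ.kernelRisk_locationKernel_le hP hmean⟩,
    fun _ hκ _ => hκ.eq_locationKernel hP hmean,
    iSup_kernelRisk_locationKernel_le hP hmean⟩

end PredictiveKernels

section PredictiveDensities

variable {d : ℕ}

/-- The predictive kernel `x ↦ p̂(y | x) dy` of a jointly measurable predictive density. -/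
noncomputable def densityKernel
    (q : EuclideanSpace ℝ (Fin d) → EuclideanSpace ℝ (Fin d) → ℝ) :
    Kernel (EuclideanSpace ℝ (Fin d)) (EuclideanSpace ℝ (Fin d)) :=
  Kernel.withDensity (Kernel.const _ volume) fun x y => ENNReal.ofReal (q x y)

theorem densityKernel_apply {q : EuclideanSpace ℝ (Fin d) → EuclideanSpace ℝ (Fin d) → ℝ}
    (hq : Measurable (Function.uncurry q)) (x : EuclideanSpace ℝ (Fin d)) :
    densityKernel q x = distOf (q x) := by
  rw [densityKernel, Kernel.withDensity_apply _ hq.ennreal_ofReal, Kernel.const_apply, distOf]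

theorem distOf_locDensity (g : EuclideanSpace ℝ (Fin d) → ℝ) (u : EuclideanSpace ℝ (Fin d)) :
    distOf (locDensity g u) = (distOf g).map (· + u) := by
  ext s hs
  have hpre : MeasurableSet ((· + u) ⁻¹' s) := measurable_add_const u hs
  rw [Measure.map_apply (by fun_prop) hs, distOf, distOf, withDensity_apply _ hs,
    withDensity_apply _ hpre]
  have h := (measurePreserving_add_right (volume : Measure (EuclideanSpace ℝ (Fin d))) u)
    |>.setLIntegral_comp_preimage_emb (MeasurableEquiv.addRight u).measurableEmbedding
      (fun z => ENNReal.ofReal (locDensity g u z)) s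
  simpa only [locDensity, add_sub_cancel_right] using h.symm

theorem locationKernel_distOf_apply (f : EuclideanSpace ℝ (Fin d) → ℝ)
    (u : EuclideanSpace ℝ (Fin d)) :
    locationKernel (distOf f) u = distOf (locDensity f u) := by
  have : SFinite (distOf f) := inferInstanceAs (SFinite (volume.withDensity _))
  rw [locationKernel_apply, distOf_locDensity]

theorem measurable_plugIn_id {f : EuclideanSpace ℝ (Fin d) → ℝ} (hf : Measurable f) :
    Measurable (Function.uncurry (plugIn f fun x => x)) :=
  hf.comp (measurable_snd.sub measurable_fst)

theorem densityKernel_plugIn_id {f : EuclideanSpace ℝ (Fin d) → ℝ} (hf : Measurable f) :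
    densityKernel (plugIn f fun x => x) = locationKernel (distOf f) := by
  ext1 x
  rw [densityKernel_apply (measurable_plugIn_id hf), locationKernel_distOf_apply]
  rfl

theorem wassersteinRisk_eq_kernelRisk (f : EuclideanSpace ℝ (Fin d) → ℝ)
    (u : EuclideanSpace ℝ (Fin d))
    {q : EuclideanSpace ℝ (Fin d) → EuclideanSpace ℝ (Fin d) → ℝ}
    (hq : Measurable (Function.uncurry q)) :
    wassersteinRisk f u q = kernelRisk (distOf f) u (densityKernel q) := by
  simp only [wassersteinRisk, kernelRisk, locationKernel_distOf_apply, densityKernel_apply hq]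

theorem wassersteinRisk_plugIn_id {f : EuclideanSpace ℝ (Fin d) → ℝ} (hf : Measurable f)
    (u : EuclideanSpace ℝ (Fin d)) :
    wassersteinRisk f u (plugIn f fun x => x) =
      kernelRisk (distOf f) u (locationKernel (distOf f)) := by
  rw [wassersteinRisk_eq_kernelRisk f u (measurable_plugIn_id hf), densityKernel_plugIn_id hf]

theorem IsEquivariant.isTranslationEquivariant_densityKernel
    {q : EuclideanSpace ℝ (Fin d) → EuclideanSpace ℝ (Fin d) → ℝ} (h : IsEquivariant q)
    (hq : Measurable (Function.uncurry q)) : IsTranslationEquivariant (densityKernel q) := by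
  intro c x
  rw [densityKernel_apply hq, densityKernel_apply hq, ← distOf_locDensity]
  refine withDensity_congr_ae ?_
  filter_upwards [(measurePreserving_sub_right volume c).quasiMeasurePreserving.ae (h c x)]
    with y hy
  rw [sub_add_cancel] at hy
  rw [hy, locDensity]

theorem isProbabilityMeasure_distOf {g : EuclideanSpace ℝ (Fin d) → ℝ} (hg0 : ∀ z, 0 ≤ g z)
    (hg1 : ∫ z, g z = 1) : IsProbabilityMeasure (distOf g) := by
  have hint : Integrable g := .of_integral_ne_zero (hg1.trans_ne one_ne_zero)
  refine ⟨?_⟩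
  rw [distOf, withDensity_apply _ MeasurableSet.univ, Measure.restrict_univ,
    ← ofReal_integral_eq_lintegral_ofReal hint (ae_of_all _ hg0), hg1, ENNReal.ofReal_one]

theorem integral_distOf {F : Type*} [NormedAddCommGroup F] [NormedSpace ℝ F]
    {g : EuclideanSpace ℝ (Fin d) → ℝ} (hg : Measurable g) (hg0 : ∀ z, 0 ≤ g z)
    (h : EuclideanSpace ℝ (Fin d) → F) : ∫ z, h z ∂(distOf g) = ∫ z, g z • h z := by
  rw [distOf, integral_withDensity_eq_integral_toReal_smul (by fun_prop)
    (ae_of_all _ fun _ => ENNReal.ofReal_lt_top)]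
  simp only [ENNReal.toReal_ofReal, hg0]

theorem memLp_id_distOf {g : EuclideanSpace ℝ (Fin d) → ℝ} (hg : Measurable g)
    (hg0 : ∀ z, 0 ≤ g z) (hg2 : Integrable fun z => ‖z‖ ^ 2 * g z) : MemLp id 2 (distOf g) := by
  rw [memLp_two_iff_integrable_sq_norm (by fun_prop), distOf,
    integrable_withDensity_iff (by fun_prop) (ae_of_all _ fun _ => ENNReal.ofReal_lt_top)]
  simpa only [id_eq, ENNReal.toReal_ofReal, hg0] using hg2

theorem ae_eq_of_distOf_eq {g h : EuclideanSpace ℝ (Fin d) → ℝ} (hg : Measurable g)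
    (hh : Measurable h) (hg0 : ∀ z, 0 ≤ g z) (hh0 : ∀ z, 0 ≤ h z) [IsFiniteMeasure (distOf g)]
    (heq : distOf g = distOf h) : g =ᵐ[volume] h := by
  have hfin : ∫⁻ z, ENNReal.ofReal (g z) ≠ ∞ := by
    rw [← setLIntegral_univ, ← withDensity_apply _ MeasurableSet.univ]
    exact measure_ne_top (distOf g) Set.univ
  filter_upwards [(withDensity_eq_iff (by fun_prop) (by fun_prop) hfin).1 heq] with z hz
  exact (ENNReal.ofReal_eq_ofReal_iff (hg0 z) (hh0 z)).1 hz

theorem isPredictiveDensity_plugIn_id {f : EuclideanSpace ℝ (Fin d) → ℝ} (hf : Measurable f)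
    (hf0 : ∀ z, 0 ≤ f z) (hf1 : ∫ z, f z = 1) : IsPredictiveDensity (plugIn f fun x => x) where
  measurable := measurable_plugIn_id hf
  nonneg _ _ := hf0 _
  integral_eq_one x := (integral_sub_right_eq_self f x).trans hf1

theorem isEquivariant_plugIn_id (f : EuclideanSpace ℝ (Fin d) → ℝ) :
    IsEquivariant (plugIn f fun x => x) := fun c x => ae_of_all _ fun y => by
  simp only [plugIn, locDensity, add_sub_add_right_eq_sub]

variable {f : EuclideanSpace ℝ (Fin d) → ℝ} (hf : Measurable f) (hf0 : ∀ z, 0 ≤ f z)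
  (hf1 : ∫ z, f z = 1) (hmean : ∫ z, f z • z = 0) (hf2 : Integrable fun z => ‖z‖ ^ 2 * f z)

include hf hf0 hf1 hmean hf2

theorem isBestEquivariant_plugIn_id : IsBestEquivariant f (plugIn f fun x => x) where
  predictive := isPredictiveDensity_plugIn_id hf hf0 hf1
  equivariant := isEquivariant_plugIn_id f
  risk_le q hq hqe u := by
    have := isProbabilityMeasure_distOf hf0 hf1
    have hbest := (mainTheorem7_general (memLp_id_distOf hf hf0 hf2)
      ((integral_distOf hf hf0 _).trans hmean)).1.2
    rw [wassersteinRisk_plugIn_id hf, wassersteinRisk_eq_kernelRisk f u hq.measurable]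
    exact hbest _ (hqe.isTranslationEquivariant_densityKernel hq.measurable) u

theorem IsBestEquivariant.ae_eq_plugIn_id
    {q : EuclideanSpace ℝ (Fin d) → EuclideanSpace ℝ (Fin d) → ℝ} (hq : IsBestEquivariant f q)
    (x : EuclideanSpace ℝ (Fin d)) : q x =ᵐ[volume] plugIn f (fun x => x) x := by
  have := isProbabilityMeasure_distOf hf0 hf1
  have := isProbabilityMeasure_distOf (hq.predictive.nonneg x) (hq.predictive.integral_eq_one x)
  have hplug := isPredictiveDensity_plugIn_id hf hf0 hf1
  have hqm := hq.predictive.measurable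
  have hunique := (mainTheorem7_general (memLp_id_distOf hf hf0 hf2)
    ((integral_distOf hf hf0 _).trans hmean)).2.1
  have hrisk := hq.risk_le _ hplug (isEquivariant_plugIn_id f) 0
  rw [wassersteinRisk_plugIn_id hf, wassersteinRisk_eq_kernelRisk f 0 hqm] at hrisk
  have hkernel : densityKernel q = densityKernel (plugIn f fun x => x) :=
    (hunique _ (hq.equivariant.isTranslationEquivariant_densityKernel hqm) 0 hrisk).trans
      (densityKernel_plugIn_id hf).symm
  refine ae_eq_of_distOf_eq hqm.of_uncurry_left hplug.measurable.of_uncurry_left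
    (hq.predictive.nonneg x) (hplug.nonneg x) ?_
  rw [← densityKernel_apply hqm, hkernel, densityKernel_apply hplug.measurable]

theorem isMinimax_plugIn_id : IsMinimax f (plugIn f fun x => x) where
  predictive := isPredictiveDensity_plugIn_id hf hf0 hf1
  sup_risk_le q hq := by
    have := isProbabilityMeasure_distOf hf0 hf1
    have hminimax := (mainTheorem7_general (memLp_id_distOf hf hf0 hf2)
      ((integral_distOf hf hf0 _).trans hmean)).2.2
    simp only [wassersteinRisk_plugIn_id hf, wassersteinRisk_eq_kernelRisk f _ hq.measurable]
    exact hminimax _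

end PredictiveDensities

theorem mainTheorem7 {d : ℕ} (f : EuclideanSpace ℝ (Fin d) → ℝ)
    (hf_meas : Measurable f) (hf_nonneg : ∀ z, 0 ≤ f z)
    (hf_int : ∫ z, f z = 1) (hf_mean : ∫ z, f z • z = 0)
    (hf_sq : Integrable fun z => ‖z‖ ^ 2 * f z) :
    IsBestEquivariant f (plugIn f fun x => x) ∧
    (∀ q, IsBestEquivariant f q → ∀ x, q x =ᵐ[volume] plugIn f (fun x => x) x) ∧
    IsMinimax f (plugIn f fun x => x) :=
  ⟨isBestEquivariant_plugIn_id hf_meas hf_nonneg hf_int hf_mean hf_sq,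
    fun _ hq => hq.ae_eq_plugIn_id hf_meas hf_nonneg hf_int hf_mean hf_sq,
    isMinimax_plugIn_id hf_meas hf_nonneg hf_int hf_mean hf_sq⟩
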